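/- Let $F$ be an infinite field and let $n \ge 2$ be an integer. For $h \ge 0$ let $C_h(F^n)$ be the free abelian group on the $(h+1)$-tuples $(\langle v_0\rangle,\dots,\langle v_h\rangle)$ of lines through the origin of $F^n$ in general position, i.e. such that every $\min\{h+1,n\}$ of the vectors $v_0,\dots,v_h$ are linearly independent. For $h \ge 1$ let $\partial_h=\sum_{i=0}^h(-1)^i d_i : C_h(F^n)\to C_{h-1}(F^n)$, where $d_i$ deletes the $i$-th line. The group $\mathrm{GL}_n=\mathrm{GL}_n(F)$ acts diagonally on each $C_h(F^n)$, and the $\partial_h$ are equivariant. Put $$H_{n-1}(X_n,\mathbb{Z}) := \ker\bigl(\partial_{n-1}: C_{n-1}(F^n)\to C_{n-2}(F^n)\bigr),$$ $$\mathfrak{t}_n(F) := H_1\bigl(\mathrm{GL}_n, H_{n-1}(X_n,\mathbb{Z})\bigr), \qquad \mathfrak{p}_n(F) := H_0\bigl(\mathrm{GL}_n, \partial_{n+1}(C_{n+1}(F^n))\bigr)$$ (group homology of the discrete group $\mathrm{GL}_n(F)$; $\mathfrak{p}_n(F)$ is the $n$-th pre-Bloch group of $F$). Then there are isomorphisms of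 abelian groups $$\mathfrak{t}_n(F) \simeq F^\ast \oplus \mathfrak{p}_n(F) \quad\text{if } n \text{ is even},\qquad \mathfrak{p}_n(F) \simeq \mathbb{Z}\oplus \mathfrak{t}_n(F) \quad\text{if } n \text{ is odd}.$$ -/

import Mathlib

open scoped LinearAlgebra.Projectivization

noncomputable section

namespace PreBloch

universe u

section Frames

variable (F : Type u) [Field F] (n : ℕ)

/-- The natural action of `GL_n(F)` on the set of lines through the origin of `F^n`:
`g` carries the line `⟨v⟩` to the line `⟨g v⟩`. -/
def glLine (g : GL (Fin n) F) (l : ℙ F (Fin n → F)) : ℙ F (Fin n → F) :=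
  Matrix.GeneralLinearGroup.toLin g • l

variable {F n} in
/-- A tuple of `m` lines in `F^n` is in general position if every `min {m, n}` of its members
are linearly independent. -/
def GeneralPosition {m : ℕ} (l : Fin m → ℙ F (Fin n → F)) : Prop :=
  ∀ s : Finset (Fin m), s.card = min m n →
    Projectivization.Independent (fun i : s => l i)

/-- The tuples `(⟨v_0⟩, …, ⟨v_h⟩)` of `h + 1` lines in `F^n` in general position. -/
def Frame (h : ℕ) : Type u :=
  {l : Fin (h + 1) → ℙ F (Fin n → F) // GeneralPosition l}

variable {F n}

theorem independent_glLine {ι : Type*} (g : GL (Fin n) F) {l : ι → ℙ F (Fin n → F)}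
    (hl : Projectivization.Independent l) :
    Projectivization.Independent (fun i => glLine F n g (l i)) := by
  obtain ⟨f, hf, hi⟩ := hl
  refine Projectivization.Independent.mk
    (fun i => Matrix.GeneralLinearGroup.toLin g • f i)
    (fun i => (smul_ne_zero_iff_ne _).mpr (hf i)) ?_
  exact hi.map' (Matrix.GeneralLinearGroup.toLin g).toLinearEquiv.toLinearMap
    (LinearEquiv.ker _)

theorem independent_comp {ι κ : Type*} {l : ι → ℙ F (Fin n → F)}
    (hl : Projectivization.Independent l) (e : κ → ι) (he : Function.Injective e) :
    Projectivization.Independent (fun i => l (e i)) := by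
  rw [Projectivization.independent_iff] at hl ⊢
  exact hl.comp e he

theorem GeneralPosition.face {m : ℕ} {l : Fin (m + 1) → ℙ F (Fin n → F)}
    (hl : GeneralPosition l) (i : Fin (m + 1)) :
    GeneralPosition (fun j => l (i.succAbove j)) := by
  intro s hs
  have h1 : (s.map i.succAboveEmb).card ≤ min (m + 1) n := by
    rw [Finset.card_map, hs]; omega
  obtain ⟨t, hst, ht⟩ := Finset.exists_superset_card_eq h1
    (by rw [Fintype.card_fin]; exact min_le_left _ _)
  refine independent_comp (hl t ht)
    (fun j : s => ⟨i.succAbove j, hst (Finset.mem_map_of_mem i.succAboveEmb j.2)⟩) ?_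
  intro a b hab
  exact Subtype.ext (Fin.succAbove_right_injective (congrArg Subtype.val hab))

/-- The face operator `d_i`, which deletes the `i`-th line. -/
def Frame.face {h : ℕ} (i : Fin (h + 2)) (x : Frame F n (h + 1)) : Frame F n h :=
  ⟨fun j => x.1 (i.succAbove j), x.2.face i⟩

/-- The diagonal action of `GL_n(F)` on tuples of lines in general position. -/
instance (h : ℕ) : MulAction (GL (Fin n) F) (Frame F n h) where
  smul g x := ⟨fun j => glLine F n g (x.1 j), fun s hs => independent_glLine g (x.2 s hs)⟩
  one_smul x := Subtype.ext (funext fun j =>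
    show glLine F n 1 (x.1 j) = x.1 j by simp [glLine])
  mul_smul g g' x := Subtype.ext (funext fun j =>
    show glLine F n (g * g') (x.1 j) = glLine F n g (glLine F n g' (x.1 j)) by
      simp [glLine, mul_smul])

theorem Frame.smul_val {h : ℕ} (g : GL (Fin n) F) (x : Frame F n h) (j : Fin (h + 1)) :
    (g • x).1 j = glLine F n g (x.1 j) := rfl

theorem Frame.face_smul {h : ℕ} (i : Fin (h + 2)) (g : GL (Fin n) F) (x : Frame F n (h + 1)) :
    (g • x).face i = g • x.face i := rfl

end Frames

section Complex

variable (k : Type u) [CommRing k] (F : Type u) [Field F] (n : ℕ)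

/-- `C_h(F^n)`: the free `k`-module on the `(h + 1)`-tuples of lines of `F^n` in general
position. -/
abbrev Chain (h : ℕ) : Type u := Frame F n h →₀ k

/-- `C_h(F^n)` as a left `GL_n(F)`-module. -/
def chainRep (h : ℕ) : Representation k (GL (Fin n) F) (Chain k F n h) where
  toFun g := Finsupp.lmapDomain k k (fun x => g • x)
  map_one' := by ext; simp
  map_mul' g g' := by ext; simp [mul_smul]

/-- The differential `∂_{h+1} = ∑_{i=0}^{h+1} (-1)^i d_i : C_{h+1}(F^n) → C_h(F^n)`. -/
def boundary (h : ℕ) : Chain k F n (h + 1) →ₗ[k] Chain k F n h :=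
  ∑ i : Fin (h + 2), (-1 : k) ^ (i : ℕ) • Finsupp.lmapDomain k k (Frame.face i)

theorem boundary_single (h : ℕ) (x : Frame F n (h + 1)) (a : k) :
    boundary k F n h (Finsupp.single x a) =
      ∑ i : Fin (h + 2), (-1 : k) ^ (i : ℕ) • Finsupp.single (x.face i) a := by
  simp [boundary, LinearMap.sum_apply]

/-- The differential `∂_{h+1}` as a `GL_n(F)`-equivariant map. -/
def boundaryHom (h : ℕ) :
    (chainRep k F n (h + 1)).IntertwiningMap (chainRep k F n h) where
  toLinearMap := boundary k F n h
  isIntertwining' g := by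
    ext x : 2
    simp [chainRep, boundary_single, Frame.face_smul, map_sum]

/-- The `GL_n(F)`-module `H_{n-1}(X_n, k) = ker (∂_{n-1} : C_{n-1}(F^n) → C_{n-2}(F^n))`,
for `n ≥ 2`. -/
def topHomology : Rep.{u} k (GL (Fin n) F) :=
  Rep.subrepresentation (Rep.of (chainRep k F n (n - 2 + 1)))
    (boundaryHom k F n (n - 2)).ker.toSubmodule
    (fun g _ hx => (boundaryHom k F n (n - 2)).ker.apply_mem_toSubmodule g hx)

/-- The `GL_n(F)`-module `∂_{n+1}(C_{n+1}(F^n))`, a submodule of `C_n(F^n)`. -/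
def boundaryImage : Rep.{u} k (GL (Fin n) F) :=
  Rep.subrepresentation (Rep.of (chainRep k F n n))
    (boundaryHom k F n n).range.toSubmodule
    (fun g _ hx => (boundaryHom k F n n).range.apply_mem_toSubmodule g hx)

/-- `t_n^{(k)}(F) = H_1(GL_n(F), H_{n-1}(X_n, k))`, for `n ≥ 2`. -/
abbrev tGroupCoeff : Type u := groupHomology (topHomology k F n) 1

/-- `H_0(GL_n(F), ∂_{n+1}(C_{n+1}(F^n)))` with coefficients in `k`. -/
abbrev preBlochCoeff : Type u := groupHomology (boundaryImage k F n) 0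

end Complex

section Integral

variable (F : Type u) [Field F] (n : ℕ)

/-- `t_n(F) = H_1(GL_n(F), H_{n-1}(X_n, ℤ))`, for `n ≥ 2`. The coefficient ring is `ℤ`, lifted to
the universe of `F` as Mathlib's group homology requires. -/
abbrev tGroup : Type u := tGroupCoeff (ULift.{u} ℤ) F n

/-- The `n`-th pre-Bloch group `𝔭_n(F) = H_0(GL_n(F), ∂_{n+1}(C_{n+1}(F^n)))`, with integral
coefficients. -/
abbrev preBlochGroup : Type u := preBlochCoeff (ULift.{u} ℤ) F n

end Integral

end PreBloch

end

open scoped LinearAlgebra.Projectivization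

noncomputable section

namespace PreBloch

universe u

/-! ### Extending tuples in general position by a generic line -/

section Extension

variable {F : Type u} [Field F] {n : ℕ}

theorem generalPosition_iff {m : ℕ} {l : Fin m → ℙ F (Fin n → F)} :
    GeneralPosition l ↔ ∀ s : Finset (Fin m), s.card ≤ n →
      LinearIndepOn F (fun i => (l i).rep) (s : Set (Fin m)) := by
  constructor
  · intro h s hs
    obtain ⟨t, hst, ht⟩ := Finset.exists_superset_card_eq
      (le_min (by simpa using s.card_le_univ) hs : s.card ≤ min m n) (by simp)
    have ht' : LinearIndepOn F (fun i => (l i).rep) (t : Set (Fin m)) :=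
      Projectivization.independent_iff.mp (h t ht)
    exact ht'.mono (by exact_mod_cast hst)
  · intro h s hs
    exact Projectivization.independent_iff.mpr (h s (hs ▸ min_le_right _ _))

/-- A line that avoids every proper subspace spanned by members of `l` extends `l` to a tuple in
general position. -/
theorem GeneralPosition.cons {m : ℕ} {l : Fin m → ℙ F (Fin n → F)} (hl : GeneralPosition l)
    {w : ℙ F (Fin n → F)}
    (hw : ∀ s : Finset (Fin m), s.card < n →
      w.rep ∉ Submodule.span F ((fun i => (l i).rep) '' (s : Set (Fin m)))) :
    GeneralPosition (Fin.cons w l : Fin (m + 1) → ℙ F (Fin n → F)) := by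
  classical
  rw [generalPosition_iff] at hl ⊢
  intro s hs
  set v : Fin (m + 1) → Fin n → F :=
    fun i => ((Fin.cons w l : Fin (m + 1) → ℙ F (Fin n → F)) i).rep with hv
  have hvs : v ∘ Fin.succ = fun i => (l i).rep := by ext i; simp [hv]
  let t : Finset (Fin m) := s.preimage Fin.succ (Fin.succ_injective _).injOn
  have hcard : (t.image Fin.succ).card = t.card :=
    Finset.card_image_of_injective _ (Fin.succ_injective _)
  have hts : t.image Fin.succ ⊆ s := by
    intro i hi
    simp only [t, Finset.mem_image, Finset.mem_preimage] at hi
    obtain ⟨j, hj, rfl⟩ := hi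
    exact hj
  have hsub : s ⊆ insert 0 (t.image Fin.succ) := by
    intro i hi
    refine Fin.cases (fun _ => by simp) (fun j hj => ?_) i hi
    simp [t, hj]
  have htn : LinearIndepOn F v (Fin.succ '' (t : Set (Fin m))) := by
    apply LinearIndepOn.image_of_comp
    rw [hvs]
    exact hl t (hcard ▸ (Finset.card_le_card hts).trans hs)
  by_cases h0 : (0 : Fin (m + 1)) ∈ s
  · have hlt : t.card < n := by
      rw [← hcard]
      refine lt_of_lt_of_le (Finset.card_lt_card ⟨hts, fun h => ?_⟩) hs
      simpa using h h0
    refine (htn.insert (x := 0) ?_).mono (by exact_mod_cast hsub)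
    rw [← Set.image_comp, hvs]
    exact hw t hlt
  · refine htn.mono fun i hi => ?_
    have := hsub hi
    rw [Finset.mem_insert] at this
    rcases this with rfl | h
    · exact absurd hi h0
    · exact_mod_cast h

theorem span_image_ne_top {m : ℕ} (v : Fin m → Fin n → F) (s : Finset (Fin m)) (hs : s.card < n) :
    Submodule.span F (v '' (s : Set (Fin m))) ≠ ⊤ := by
  classical
  intro h
  have h1 := finrank_span_finset_le_card (R := F) (s.image v)
  have h2 : (((s.image v : Finset _) : Set (Fin n → F)).finrank F) = n := by
    rw [Finset.coe_image, Set.finrank, h, finrank_top, Module.finrank_fin_fun]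
  have h3 : (s.image v).card ≤ s.card := Finset.card_image_le
  omega

/-- Over an infinite field, finitely many tuples in general position have a common extension. -/
theorem exists_generalPosition_cons [Infinite F] {m : ℕ} (hn : 0 < n)
    (T : Finset (Fin m → ℙ F (Fin n → F))) (hT : ∀ l ∈ T, GeneralPosition l) :
    ∃ w : ℙ F (Fin n → F), ∀ l ∈ T,
      GeneralPosition (Fin.cons w l : Fin (m + 1) → ℙ F (Fin n → F)) := by
  classical
  -- A vector space over an infinite field is not a finite union of proper subspaces. Including `⊥`
  -- makes the avoiding vector nonzero.
  let S : Finset (Submodule F (Fin n → F)) :=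
    insert ⊥ ((T ×ˢ (Finset.univ.filter fun s : Finset (Fin m) => s.card < n)).image fun p =>
      Submodule.span F ((fun i => (p.1 i).rep) '' (p.2 : Set (Fin m))))
  have hS : (⊤ : Submodule F (Fin n → F)) ∉ S := by
    have : Nonempty (Fin n) := ⟨⟨0, hn⟩⟩
    simp only [S, Finset.mem_insert, Finset.mem_image, Finset.mem_product, Finset.mem_filter,
      Finset.mem_univ, true_and, not_or, not_exists, not_and]
    exact ⟨top_ne_bot, fun p hp => span_image_ne_top _ _ hp.2⟩
  have := Subspace.biUnion_ne_univ_of_top_notMem hS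
  rw [Ne, Set.eq_univ_iff_forall, not_forall] at this
  obtain ⟨v, hv⟩ := this
  simp only [Set.mem_iUnion, not_exists, SetLike.mem_coe] at hv
  have hv0 : v ≠ 0 := fun h => hv ⊥ (by simp [S]) (by simp [h])
  refine ⟨Projectivization.mk F v hv0, fun l hl => (hT l hl).cons fun s hs h => ?_⟩
  obtain ⟨a, ha⟩ := Projectivization.exists_smul_eq_mk_rep F v hv0
  rw [← ha, Units.smul_def, Submodule.smul_mem_iff _ a.ne_zero] at h
  refine hv _ ?_ h
  simp only [S, Finset.mem_insert, Finset.mem_image, Finset.mem_product, Finset.mem_filter,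
    Finset.mem_univ, true_and]
  exact Or.inr ⟨(l, s), ⟨hl, hs⟩, rfl⟩

theorem nonempty_frame [Infinite F] (hn : 0 < n) (h : ℕ) : Nonempty (Frame F n h) := by
  have key : ∀ m : ℕ, ∃ l : Fin m → ℙ F (Fin n → F), GeneralPosition l := by
    intro m
    induction m with
    | zero =>
      refine ⟨Fin.elim0, generalPosition_iff.mpr fun s _ => ?_⟩
      rw [Finset.eq_empty_of_isEmpty s, Finset.coe_empty]
      exact linearIndepOn_empty _ _
    | succ m ih =>
      obtain ⟨l, hl⟩ := ih
      obtain ⟨w, hw⟩ := exists_generalPosition_cons hn {l} (by simpa using hl)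
      exact ⟨_, hw l (by simp)⟩
  obtain ⟨l, hl⟩ := key (h + 1)
  exact ⟨⟨l, hl⟩⟩

end Extension

/-! ### Exactness of the complex of tuples in general position -/

section Exactness

variable (k : Type u) [CommRing k] {F : Type u} [Field F] {n : ℕ}

theorem Frame.face_face {h : ℕ} (x : Frame F n (h + 2)) (i : Fin (h + 3)) (j : Fin (h + 2)) :
    (x.face (i.succAbove j)).face (j.predAbove i) = (x.face i).face j :=
  Subtype.ext (funext fun l => congrArg x.1 (Fin.succAbove_succAbove_succAbove_predAbove i j l))

/-- Deleting two lines in either order gives the same tuple with opposite signs; the involution on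
pairs of indices matches these terms. -/
theorem boundary_boundary_single (h : ℕ) (x : Frame F n (h + 2)) (a : k) :
    boundary k F n h (boundary k F n (h + 1) (Finsupp.single x a)) = 0 := by
  simp only [boundary_single, map_sum, map_smul, Finset.smul_sum, smul_smul, ← pow_add]
  rw [Finset.sum_sigma']
  refine Finset.sum_involution (fun p _ => ⟨p.1.succAbove p.2, p.2.predAbove p.1⟩) ?_ ?_ ?_ ?_
  · rintro ⟨i, j⟩ -
    simp [Fin.neg_one_pow_succAbove_add_predAbove, Frame.face_face]
  · rintro ⟨i, j⟩ - - h
    exact Fin.succAbove_ne i j (congrArg Sigma.fst h)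
  · simp
  · rintro ⟨i, j⟩ -
    simp [Fin.succAbove_succAbove_predAbove, Fin.predAbove_predAbove_succAbove]

theorem boundary_comp_boundary (h : ℕ) :
    boundary k F n h ∘ₗ boundary k F n (h + 1) = 0 := by
  ext x : 2
  simpa using boundary_boundary_single k h x 1

/-- The tuples that stay in general position when the line `w` is added. -/
def Frame.Extendable (w : ℙ F (Fin n → F)) {h : ℕ} (x : Frame F n h) : Prop :=
  GeneralPosition (Fin.cons w x.1 : Fin (h + 2) → ℙ F (Fin n → F))

/-- The tuple `(w, x_0, …, x_h)`. -/
def Frame.cons (w : ℙ F (Fin n → F)) {h : ℕ} (x : Frame F n h) (hx : x.Extendable w) :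
    Frame F n (h + 1) := ⟨Fin.cons w x.1, hx⟩

theorem Frame.face_zero_cons (w : ℙ F (Fin n → F)) {h : ℕ} (x : Frame F n h)
    (hx : x.Extendable w) : (x.cons w hx).face 0 = x :=
  Subtype.ext (funext fun j => by simp [Frame.face, Frame.cons])

theorem Frame.cons_face_val (w : ℙ F (Fin n → F)) {h : ℕ} (x : Frame F n (h + 1))
    (i : Fin (h + 2)) :
    (Fin.cons w (x.face i).1 : Fin (h + 2) → ℙ F (Fin n → F)) =
      fun j => (Fin.cons w x.1 : Fin (h + 3) → ℙ F (Fin n → F)) (i.succ.succAbove j) := by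
  funext j
  refine Fin.cases ?_ (fun j => ?_) j
  · simp
  · simp [Frame.face]

theorem Frame.Extendable.face {w : ℙ F (Fin n → F)} {h : ℕ} {x : Frame F n (h + 1)}
    (hx : x.Extendable w) (i : Fin (h + 2)) : (x.face i).Extendable w := by
  unfold Frame.Extendable
  rw [Frame.cons_face_val]
  exact GeneralPosition.face hx i.succ

theorem Frame.face_succ_cons (w : ℙ F (Fin n → F)) {h : ℕ} (x : Frame F n (h + 1))
    (hx : x.Extendable w) (i : Fin (h + 2)) :
    (x.cons w hx).face i.succ = (x.face i).cons w (hx.face i) :=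
  Subtype.ext (Frame.cons_face_val w x i).symm

open Classical in
/-- The cone with apex `w`, set to zero on the tuples that `w` does not extend. -/
def cone (w : ℙ F (Fin n → F)) (h : ℕ) : Chain k F n h →ₗ[k] Chain k F n (h + 1) :=
  Finsupp.lsum k fun x =>
    if hx : x.Extendable w then Finsupp.lsingle (x.cons w hx) else 0

theorem cone_single (w : ℙ F (Fin n → F)) {h : ℕ} (x : Frame F n h) (hx : x.Extendable w) (a : k) :
    cone k w h (Finsupp.single x a) = Finsupp.single (x.cons w hx) a := by
  simp [cone, hx]

theorem boundary_cone_single (w : ℙ F (Fin n → F)) {h : ℕ} (x : Frame F n (h + 1))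
    (hx : x.Extendable w) (a : k) :
    boundary k F n (h + 1) (cone k w (h + 1) (Finsupp.single x a)) =
      Finsupp.single x a - cone k w h (boundary k F n h (Finsupp.single x a)) := by
  rw [cone_single k w x hx, boundary_single, Fin.sum_univ_succ, Frame.face_zero_cons]
  simp only [boundary_single, map_sum, map_smul, Frame.face_succ_cons, cone_single k w _ (hx.face _)]
  simp [pow_succ, sub_eq_add_neg]

/-- The apex is chosen generic for the finite support of `z`. The cone is then a contracting
homotopy along that support, though not on the whole complex. -/
theorem exists_boundary_eq [Infinite F] (hn : 0 < n) {h : ℕ} {z : Chain k F n (h + 1)}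
    (hz : boundary k F n h z = 0) : ∃ y, boundary k F n (h + 1) y = z := by
  classical
  obtain ⟨w, hw⟩ := exists_generalPosition_cons hn (z.support.image Subtype.val)
    (by intro l hl; obtain ⟨x, -, rfl⟩ := Finset.mem_image.mp hl; exact x.2)
  have hw' : ∀ x ∈ z.support, x.Extendable w := fun x hx => hw _ (Finset.mem_image_of_mem _ hx)
  refine ⟨cone k w (h + 1) z, ?_⟩
  have key : boundary k F n (h + 1) (cone k w (h + 1) z) = z - cone k w h (boundary k F n h z) := by
    conv_lhs => rw [← Finsupp.sum_single z]
    conv_rhs => rw [← Finsupp.sum_single z]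
    simp only [Finsupp.sum, map_sum, ← Finset.sum_sub_distrib]
    exact Finset.sum_congr rfl fun x hx => boundary_cone_single k w x (hw' x hx) _
  rw [key, hz, map_zero, sub_zero]

end Exactness

/-! ### Transitivity and stabilizers on tuples of `n + 1` lines -/

section Stabilizer

open Matrix

variable {F : Type u} [Field F] {n : ℕ}

theorem mulVec_ne_zero (g : GL (Fin n) F) {v : Fin n → F} (hv : v ≠ 0) : g.1 *ᵥ v ≠ 0 := by
  intro h
  have := congrArg (g⁻¹.1 *ᵥ ·) h
  simp only [mulVec_mulVec, ← Units.val_mul, inv_mul_cancel, Units.val_one, one_mulVec,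
    mulVec_zero] at this
  exact hv this

theorem glLine_mk (g : GL (Fin n) F) {v : Fin n → F} (hv : v ≠ 0) :
    glLine F n g (Projectivization.mk F v hv) =
      Projectivization.mk F (g.1 *ᵥ v) (mulVec_ne_zero g hv) := rfl

theorem glLine_mul (g h : GL (Fin n) F) (l : ℙ F (Fin n → F)) :
    glLine F n (g * h) l = glLine F n g (glLine F n h l) := by
  simp [glLine, mul_smul]

theorem glLine_one (l : ℙ F (Fin n → F)) : glLine F n 1 l = l := by simp [glLine]

theorem scalar_mulVec (a : Fˣ) (v : Fin n → F) :
    (GeneralLinearGroup.scalar (Fin n) a).1 *ᵥ v = (a : F) • v := by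
  rw [GeneralLinearGroup.coe_scalar, scalar_apply, ← smul_one_eq_diagonal, smul_mulVec, one_mulVec]

theorem glLine_scalar (a : Fˣ) (l : ℙ F (Fin n → F)) :
    glLine F n (GeneralLinearGroup.scalar (Fin n) a) l = l := by
  induction l with
  | h v hv =>
    rw [glLine_mk, Projectivization.mk_eq_mk_iff]
    exact ⟨a, (scalar_mulVec a v).symm⟩

theorem scalar_smul_frame (a : Fˣ) {h : ℕ} (x : Frame F n h) :
    GeneralLinearGroup.scalar (Fin n) a • x = x :=
  Subtype.ext (funext fun _ => glLine_scalar a _)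

theorem exists_mulVec_rep (g : GL (Fin n) F) (l : ℙ F (Fin n → F)) :
    ∃ c : Fˣ, g.1 *ᵥ (glLine F n g⁻¹ l).rep = c • l.rep := by
  have h : glLine F n g (glLine F n g⁻¹ l) = l := by
    rw [← glLine_mul, mul_inv_cancel, glLine_one]
  rw [← Projectivization.mk_rep (glLine F n g⁻¹ l), glLine_mk] at h
  conv_rhs at h => rw [← Projectivization.mk_rep l]
  obtain ⟨c, hc⟩ := (Projectivization.mk_eq_mk_iff ..).mp h
  exact ⟨c, hc.symm⟩

/-- The factor by which `g` scales the chosen representatives of `g⁻¹ l` and `l`. -/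
def lineFactor (g : GL (Fin n) F) (l : ℙ F (Fin n → F)) : Fˣ :=
  (exists_mulVec_rep g l).choose

theorem lineFactor_spec (g : GL (Fin n) F) (l : ℙ F (Fin n → F)) :
    g.1 *ᵥ (glLine F n g⁻¹ l).rep = lineFactor g l • l.rep :=
  (exists_mulVec_rep g l).choose_spec

theorem lineFactor_eq {g : GL (Fin n) F} {l : ℙ F (Fin n → F)} {c : Fˣ}
    (h : g.1 *ᵥ (glLine F n g⁻¹ l).rep = c • l.rep) : lineFactor g l = c := by
  rw [lineFactor_spec, Units.smul_def, Units.smul_def] at h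
  exact Units.ext (smul_left_injective F l.rep_nonzero h)

/-- This twisted multiplicativity is the cocycle relation dual to `d₂₁`, which lets the factor
descend to `H_1`. -/
theorem lineFactor_mul (g h : GL (Fin n) F) (l : ℙ F (Fin n → F)) :
    lineFactor (g * h) l = lineFactor h (glLine F n g⁻¹ l) * lineFactor g l := by
  apply lineFactor_eq
  rw [_root_.mul_inv_rev, glLine_mul, Units.val_mul, ← mulVec_mulVec, lineFactor_spec h, Units.smul_def,
    mulVec_smul, lineFactor_spec g, mul_smul, Units.smul_def, Units.smul_def]

theorem lineFactor_scalar (a : Fˣ) (l : ℙ F (Fin n → F)) :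
    lineFactor (GeneralLinearGroup.scalar (Fin n) a) l = a := by
  apply lineFactor_eq
  rw [← map_inv, glLine_scalar, scalar_mulVec, Units.smul_def]

/-- A tuple of `n + 1` lines in general position is spanned by a basis and the sum of its
members. -/
theorem Frame.exists_basis (x : Frame F n n) :
    ∃ b : Module.Basis (Fin n) F (Fin n → F),
      (∀ i : Fin n, ∃ hv, x.1 i.castSucc = Projectivization.mk F (b i) hv) ∧
      ∃ hv, x.1 (Fin.last n) = Projectivization.mk F (∑ i, b i) hv := by
  classical
  have hx := generalPosition_iff.mp x.2
  have hli : LinearIndependent F (fun i : Fin n => (x.1 i.castSucc).rep) := by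
    have h1 := hx (Finset.univ.image Fin.castSucc) (by
      rw [Finset.card_image_of_injective _ (Fin.castSucc_injective n)]; simp)
    rw [Finset.coe_image] at h1
    have h2 := h1.comp_of_image (Fin.castSucc_injective n).injOn
    rwa [Finset.coe_univ, linearIndepOn_univ_iff] at h2
  let b₀ : Module.Basis (Fin n) F (Fin n → F) := Module.Basis.mk hli
    (hli.span_eq_top_of_card_eq_finrank' (by simp)).ge
  have hb₀ : ∀ i, b₀ i = (x.1 i.castSucc).rep := fun i => by simp [b₀]
  let c := b₀.repr (x.1 (Fin.last n)).rep
  have hsum : ∑ i, c i • b₀ i = (x.1 (Fin.last n)).rep := b₀.sum_repr _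
  -- If `c i = 0`, the expansion of the last line is a linear relation among the `n` lines other
  -- than the `i`-th, which are independent.
  have hc : ∀ i, c i ≠ 0 := by
    intro i hi
    let d : Fin (n + 1) → F := Fin.snoc c (-1)
    have h1 := hx (Finset.univ.erase i.castSucc) (by simp)
    have h2 : ∑ j, d j • (x.1 j).rep = 0 := by
      rw [Fin.sum_univ_castSucc]
      simp only [d, Fin.snoc_castSucc, Fin.snoc_last, ← hb₀, hsum, neg_smul, one_smul,
        add_neg_cancel]
    rw [← Finset.add_sum_erase _ _ (Finset.mem_univ i.castSucc)] at h2
    have h3 : d i.castSucc = 0 := by simpa [d] using hi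
    rw [h3, zero_smul, zero_add] at h2
    have h4 := linearIndepOn_finset_iff.mp h1 d h2 (Fin.last n) (by simp [Fin.ext_iff, i.2.ne'])
    simp [d] at h4
  refine ⟨b₀.unitsSMul fun i => Units.mk0 (c i) (hc i), fun i => ⟨Module.Basis.ne_zero _ i, ?_⟩, ?_⟩
  · conv_lhs => rw [← Projectivization.mk_rep (x.1 i.castSucc)]
    rw [Projectivization.mk_eq_mk_iff]
    refine ⟨(Units.mk0 (c i) (hc i))⁻¹, ?_⟩
    rw [Module.Basis.unitsSMul_apply, inv_smul_smul, hb₀]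
  · have h : ∑ i, b₀.unitsSMul (fun i => Units.mk0 (c i) (hc i)) i = (x.1 (Fin.last n)).rep := by
      rw [← hsum]
      exact Finset.sum_congr rfl fun i _ => by rw [Module.Basis.unitsSMul_apply]; rfl
    refine ⟨h ▸ (x.1 (Fin.last n)).rep_nonzero, ?_⟩
    simp only [h, Projectivization.mk_rep]

/-- The change of basis between the normalized bases of `x` and `y` also matches the sums of their
vectors, hence the last lines. -/
theorem Frame.exists_smul_eq (x y : Frame F n n) : ∃ g : GL (Fin n) F, g • x = y := by
  obtain ⟨b, hb, hbs, hbl⟩ := x.exists_basis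
  obtain ⟨b', hb', hbs', hbl'⟩ := y.exists_basis
  let g : GL (Fin n) F := GeneralLinearGroup.toLin.symm
    (LinearMap.GeneralLinearGroup.ofLinearEquiv (b.equiv b' (Equiv.refl _)))
  have hg : ∀ v, g.1 *ᵥ v = b.equiv b' (Equiv.refl _) v := by
    intro v
    change GeneralLinearGroup.toLin g • v = _
    rw [MulEquiv.apply_symm_apply]
    rfl
  have hgb : ∀ i, g.1 *ᵥ b i = b' i := fun i => by simp [hg]
  refine ⟨g, Subtype.ext (funext fun j => ?_)⟩
  rw [Frame.smul_val]
  refine Fin.lastCases ?_ (fun i => ?_) j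
  · rw [hbl, hbl', glLine_mk]
    simp only [mulVec_sum, hgb]
  · obtain ⟨h1, h2⟩ := hb i
    obtain ⟨h3, h4⟩ := hb' i
    rw [h2, h4, glLine_mk]
    simp only [hgb]

/-- Fixing the first `n` lines makes `g` diagonal in the normalized basis; fixing the line of the
sum makes the diagonal entries equal. -/
theorem Frame.eq_scalar_of_smul_eq {x : Frame F n n} {g : GL (Fin n) F} (hg : g • x = x) :
    ∃ a : Fˣ, g = GeneralLinearGroup.scalar (Fin n) a := by
  obtain ⟨b, hb, hbs, hbl⟩ := x.exists_basis
  have hgx : ∀ j, glLine F n g (x.1 j) = x.1 j := fun j => by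
    rw [← Frame.smul_val, hg]
  have h1 : ∀ i, ∃ a : Fˣ, a • b i = g.1 *ᵥ b i := fun i => by
    obtain ⟨hv, h⟩ := hb i
    have := hgx i.castSucc
    rw [h, glLine_mk, Projectivization.mk_eq_mk_iff] at this
    exact this
  choose a ha using h1
  have h2 := hgx (Fin.last n)
  rw [hbl, glLine_mk, Projectivization.mk_eq_mk_iff] at h2
  obtain ⟨c, hc⟩ := h2
  have h3 : ∑ i, (c : F) • b i = ∑ i, (a i : F) • b i := by
    rw [← Finset.smul_sum, ← Units.smul_def, hc, mulVec_sum]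
    exact Finset.sum_congr rfl fun i _ => by rw [← ha, Units.smul_def]
  have h4 : ∀ i, (c : F) = a i := fun i => by
    have := congrArg (fun v => b.repr v i) h3
    simpa only [b.repr_sum_self] using this
  refine ⟨c, Units.ext (Matrix.toLin'.injective (b.ext fun i => ?_))⟩
  rw [toLin'_apply, toLin'_apply, scalar_mulVec, ← ha, Units.smul_def, h4 i]

end Stabilizer

/-! ### Classes of scalar matrices, and the augmentation -/

section ScalarClass

open CategoryTheory groupHomology Matrix

variable {k : Type u} [CommRing k]

theorem single_mul_sub_mem_boundaries₁ {G : Type u} [Group G] (A : Rep.{u} k G) (g h : G) (c : A) :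
    (Finsupp.single (g * h) c - Finsupp.single h (A.ρ g⁻¹ c) - Finsupp.single g c : G →₀ A) ∈
      boundaries₁ A := by
  refine ⟨-Finsupp.single (g, h) c, ?_⟩
  change d₂₁ A (-Finsupp.single (g, h) c) = _
  rw [map_neg, d₂₁_single]
  abel

variable {F : Type u} [Field F] {n : ℕ}

/-- The scalar matrices act trivially on `A`. -/
def ScalarTrivial (A : Rep.{u} k (GL (Fin n) F)) : Prop :=
  ∀ (a : Fˣ) (c : A), A.ρ (GeneralLinearGroup.scalar (Fin n) a) c = c

/-- The class in `H_1(GL_n, A)` of the scalar matrix `a` with a coefficient in `A`. -/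
def scalarClass (A : Rep.{u} k (GL (Fin n) F)) (hA : ScalarTrivial A) (a : Fˣ) :
    A →ₗ[k] H1 A :=
  (H1π A).hom ∘ₗ (Finsupp.lsingle (GeneralLinearGroup.scalar (Fin n) a)).codRestrict (cycles₁ A)
    (fun c => (single_mem_cycles₁_iff _ _).mpr (hA a c))

theorem scalarClass_apply (A : Rep.{u} k (GL (Fin n) F)) (hA : ScalarTrivial A) (a : Fˣ) (c : A) :
    scalarClass A hA a c = H1π A ⟨Finsupp.single (GeneralLinearGroup.scalar (Fin n) a) c,
      (single_mem_cycles₁_iff _ _).mpr (hA a c)⟩ := rfl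

theorem scalarClass_mul (A : Rep.{u} k (GL (Fin n) F)) (hA : ScalarTrivial A) (a b : Fˣ) (c : A) :
    scalarClass A hA (a * b) c = scalarClass A hA a c + scalarClass A hA b c := by
  simp only [scalarClass_apply]
  rw [← map_add, H1π_eq_iff]
  have := single_mul_sub_mem_boundaries₁ A (GeneralLinearGroup.scalar (Fin n) a)
    (GeneralLinearGroup.scalar (Fin n) b) c
  rw [← map_inv, hA, ← map_mul, sub_sub, add_comm] at this
  exact this

/-- The scalar commutes with `g⁻¹`, so the boundaries attached to the two orders of the product
differ by exactly the required relation. -/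
theorem scalarClass_rho (A : Rep.{u} k (GL (Fin n) F)) (hA : ScalarTrivial A) (a : Fˣ)
    (g : GL (Fin n) F) (c : A) :
    scalarClass A hA a (A.ρ g c) = scalarClass A hA a c := by
  simp only [scalarClass_apply]
  rw [H1π_eq_iff]
  have h1 := single_mul_sub_mem_boundaries₁ A (GeneralLinearGroup.scalar (Fin n) a) g⁻¹ c
  have h2 := single_mul_sub_mem_boundaries₁ A g⁻¹ (GeneralLinearGroup.scalar (Fin n) a) c
  rw [← map_inv, hA, GeneralLinearGroup.scalar_commute] at h1
  rw [inv_inv] at h2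
  have h3 := sub_mem h1 h2
  convert h3 using 1
  abel

/-- The homomorphism `a ↦ [a ⊗ c]` from `F^*` to `H_1(GL_n, A)`. -/
def scalarHom (A : Rep.{u} k (GL (Fin n) F)) (hA : ScalarTrivial A) (c : A) :
    Additive Fˣ →+ H1 A :=
  AddMonoidHom.mk' (fun a => scalarClass A hA a.toMul c) fun _ _ => scalarClass_mul A hA _ _ c

theorem map_scalarClass {A B : Rep.{u} k (GL (Fin n) F)} (f : A ⟶ B) (hA : ScalarTrivial A)
    (hB : ScalarTrivial B) (a : Fˣ) (c : A) :
    groupHomology.map (MonoidHom.id _) f 1 (scalarClass A hA a c) =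
      scalarClass B hB a (f.hom c) := by
  rw [scalarClass_apply, scalarClass_apply]
  have h := ConcreteCategory.congr_hom (H1π_comp_map (MonoidHom.id _) f)
    ⟨Finsupp.single (GeneralLinearGroup.scalar (Fin n) a) c,
      (single_mem_cycles₁_iff _ _).mpr (hA a c)⟩
  refine h.trans ?_
  change H1π B _ = H1π B _
  congr 1
  apply Subtype.ext
  refine (coe_mapCycles₁ (MonoidHom.id _) f _).trans ?_
  simp

theorem chainRep_single (h : ℕ) (g : GL (Fin n) F) (x : Frame F n h) (a : k) :
    chainRep k F n h g (Finsupp.single x a) = Finsupp.single (g • x) a := by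
  simp [chainRep]

theorem scalarTrivial_chainRep (h : ℕ) : ScalarTrivial (Rep.of (chainRep k F n h)) := by
  intro a c
  suffices chainRep k F n h (GeneralLinearGroup.scalar (Fin n) a) = LinearMap.id from
    LinearMap.congr_fun this c
  ext x : 2
  simp [chainRep_single, scalar_smul_frame]

theorem ScalarTrivial.subrepresentation {A : Rep.{u} k (GL (Fin n) F)} (hA : ScalarTrivial A)
    (W : Submodule k A) (hW : ∀ g, W ≤ W.comap (A.ρ g)) :
    ScalarTrivial (Rep.subrepresentation A W hW) :=
  fun a c => Subtype.ext (hA a c.1)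

variable (k) in
/-- The sum of the coefficients of a chain. -/
def augmentation (h : ℕ) : Chain k F n h →ₗ[k] k :=
  Finsupp.linearCombination k fun _ => 1

theorem augmentation_single (h : ℕ) (x : Frame F n h) (a : k) :
    augmentation k h (Finsupp.single x a) = a := by simp [augmentation]

/-- There are `h + 2` faces with alternating signs. This is the source of the dichotomy between even
and odd `n`. -/
theorem augmentation_boundary (h : ℕ) (c : Chain k F n (h + 1)) :
    augmentation k h (boundary k F n h c) = if Even h then 0 else augmentation k (h + 1) c := by
  suffices augmentation k h ∘ₗ boundary k F n h =
      if Even h then 0 else augmentation k (F := F) (n := n) (h + 1) by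
    have := LinearMap.congr_fun this c
    split_ifs at * <;> exact this
  ext x
  have : ∑ i : Fin (h + 2), (-1 : k) ^ (i : ℕ) = if Even h then 0 else 1 := by
    rw [Fin.sum_neg_one_pow]
    simp [Nat.even_add]
  split_ifs at * <;> simpa [boundary_single, augmentation_single]

theorem augmentation_chainRep (h : ℕ) (g : GL (Fin n) F) :
    augmentation k h ∘ₗ chainRep k F n h g = augmentation k h := by
  ext x
  simp [chainRep_single, augmentation_single]

/-- As `GL_n` is transitive on the frames of `n + 1` lines, a chain is determined by its
augmentation modulo coinvariants. -/
theorem single_sub_mem_coinvariantsKer (x₀ : Frame F n n) (c : Chain k F n n) :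
    c - Finsupp.single x₀ (augmentation k n c) ∈
      Representation.Coinvariants.ker (chainRep k F n n) := by
  induction c using Finsupp.induction_linear with
  | zero => simp
  | add c d hc hd =>
    convert add_mem hc hd using 1
    rw [map_add, Finsupp.single_add]
    abel
  | single x a =>
    obtain ⟨g, rfl⟩ := Frame.exists_smul_eq x₀ x
    rw [augmentation_single, ← chainRep_single]
    exact Representation.Coinvariants.sub_mem_ker _ _

/-- All tuples of `n + 1` lines are translates of `x₀`, and translating the coefficient does not
change the class. -/
theorem scalarClass_chainRep (x₀ : Frame F n n) (a : Fˣ) (c : Chain k F n n) :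
    scalarClass (Rep.of (chainRep k F n n)) (scalarTrivial_chainRep n) a c =
      augmentation k n c •
        scalarClass (Rep.of (chainRep k F n n)) (scalarTrivial_chainRep n) a
          (Finsupp.single x₀ 1) := by
  suffices scalarClass (Rep.of (chainRep k F n n)) (scalarTrivial_chainRep n) a =
      (augmentation k n).smulRight (scalarClass (Rep.of (chainRep k F n n))
        (scalarTrivial_chainRep n) a (Finsupp.single x₀ 1)) from LinearMap.congr_fun this c
  ext x
  obtain ⟨g, rfl⟩ := Frame.exists_smul_eq x₀ x
  simp only [LinearMap.comp_apply, Finsupp.lsingle_apply, LinearMap.smulRight_apply,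
    augmentation_single, one_smul]
  rw [← chainRep_single]
  exact scalarClass_rho _ _ _ _ _

theorem scalarClass_congr (x₀ : Frame F n n) (a : Fˣ) {c d : Chain k F n n}
    (h : augmentation k n c = augmentation k n d) :
    scalarClass (Rep.of (chainRep k F n n)) (scalarTrivial_chainRep n) a c =
      scalarClass (Rep.of (chainRep k F n n)) (scalarTrivial_chainRep n) a d := by
  rw [scalarClass_chainRep x₀ a c, scalarClass_chainRep x₀ a d, h]

variable (k) in
/-- The map `H_0(GL_n, C_h(F^n)) → k` induced by the augmentation. -/
def augmentationH0 (h : ℕ) : H0 (Rep.of (chainRep k F n h)) →ₗ[k] k :=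
  Representation.Coinvariants.lift _ (augmentation k h) (augmentation_chainRep h) ∘ₗ
    (H0Iso (Rep.of (chainRep k F n h))).hom.hom

theorem H0Iso_hom_H0π {G : Type u} [Group G] (A : Rep.{u} k G) (c : A) :
    (H0Iso A).hom (H0π A c) = Representation.Coinvariants.mk A.ρ c :=
  ConcreteCategory.congr_hom (H0π_comp_H0Iso_hom A) c

theorem map_H0π {G : Type u} [Group G] {A B : Rep.{u} k G} (f : A ⟶ B) (c : A) :
    groupHomology.map (MonoidHom.id G) f 0 (H0π A c) = H0π B (f.hom c) :=
  ConcreteCategory.congr_hom (H0π_comp_map (MonoidHom.id G) f) c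

theorem augmentationH0_H0π (h : ℕ) (c : Chain k F n h) :
    augmentationH0 k h (H0π (Rep.of (chainRep k F n h)) c) = augmentation k h c := by
  change Representation.Coinvariants.lift _ _ (augmentation_chainRep h) ((H0Iso (Rep.of (chainRep k F n h))).hom
    (H0π (Rep.of (chainRep k F n h)) c)) = _
  rw [H0Iso_hom_H0π]
  rfl

theorem augmentationH0_injective (x₀ : Frame F n n) :
    Function.Injective (augmentationH0 k n : H0 (Rep.of (chainRep k F n n)) →ₗ[k] k) := by
  rw [injective_iff_map_eq_zero]
  intro z
  induction z using H0_induction_on with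
  | h c =>
    intro hc
    rw [augmentationH0_H0π] at hc
    have h1 := single_sub_mem_coinvariantsKer x₀ c
    rw [hc, Finsupp.single_zero, sub_zero] at h1
    have h2 : (H0Iso (Rep.of (chainRep k F n n))).hom (H0π (Rep.of (chainRep k F n n)) c) = 0 := by
      rw [H0Iso_hom_H0π]
      exact Representation.Coinvariants.mk_eq_zero _ |>.mpr h1
    have h3 := congrArg (H0Iso (Rep.of (chainRep k F n n))).inv h2
    rwa [Iso.hom_inv_id_apply, map_zero] at h3

end ScalarClass

/-! ### First homology of `C_n(F^n)` and the action on a line -/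

section FirstHomology

open CategoryTheory groupHomology Matrix

variable {F : Type u} [Field F] {n : ℕ}

theorem H1π_eq_of_sub_mem {k G : Type u} [CommRing k] [Group G] (A : Rep.{u} k G)
    {x y : cycles₁ A} (h : x.1 - y.1 ∈ boundaries₁ A) : H1π A x = H1π A y :=
  (H1π_eq_iff x y).mpr h

/-- `H_1(GL_n, C_n(F^n))` is the first homology of the stabilizer `F^*` of a frame: it consists of
the classes of the scalar matrices. -/
theorem exists_scalarHom_eq (x₀ : Frame F n n) (z : H1 (Rep.of (chainRep (ULift.{u} ℤ) F n n))) :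
    ∃ a, scalarHom (Rep.of (chainRep (ULift.{u} ℤ) F n n)) (scalarTrivial_chainRep n)
      (Finsupp.single x₀ 1) a = z := by
  revert z
  set A := Rep.of (chainRep (ULift.{u} ℤ) F n n)
  choose t ht using fun x : Frame F n n => Frame.exists_smul_eq x₀ x
  -- With `t x` carrying `x₀` to `x`, this is a homotopy retracting 1-chains, modulo boundaries,
  -- onto those supported on the stabilizer of `x₀`.
  let σ : Chain (ULift.{u} ℤ) F n n →ₗ[ULift.{u} ℤ] (GL (Fin n) F →₀ A) :=
    Finsupp.lsum (ULift.{u} ℤ) fun x =>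
      Finsupp.lsingle (t x) ∘ₗ (Finsupp.lsingle x : ULift.{u} ℤ →ₗ[ULift.{u} ℤ] Chain _ F n n)
  have hσ : ∀ x m, σ (Finsupp.single x m) = Finsupp.single (t x) (Finsupp.single x m) :=
    fun x m => by simp [σ]; rfl
  let q := (boundaries₁ A).mkQ
  let Φ : Additive Fˣ →+ (GL (Fin n) F →₀ A) ⧸ boundaries₁ A :=
    AddMonoidHom.mk' (fun a => q (Finsupp.single (GeneralLinearGroup.scalar (Fin n) a.toMul)
      (Finsupp.single x₀ 1))) fun a b => by
        have := single_mul_sub_mem_boundaries₁ A (GeneralLinearGroup.scalar (Fin n) a.toMul)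
          (GeneralLinearGroup.scalar (Fin n) b.toMul) (Finsupp.single x₀ 1)
        rw [← map_inv, scalarTrivial_chainRep, ← map_mul] at this
        rw [← map_add]
        refine (Submodule.Quotient.eq _).mpr ?_
        convert this using 1
        rw [toMul_add]
        abel
  have key : ∀ c : GL (Fin n) F →₀ A, q (c + σ (d₁₀ A c)) ∈ Φ.range := by
    intro c
    induction c using Finsupp.induction_linear with
    | zero => simp
    | add c d hc hd =>
      convert add_mem hc hd using 1
      simp only [map_add]
      abel
    | single g c =>
      change Chain (ULift.{u} ℤ) F n n at c
      induction c using Finsupp.induction_linear with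
      | zero => rw [Finsupp.single_zero]; simp
      | add c d hc hd =>
        convert add_mem hc hd using 1
        rw [Finsupp.single_add]
        simp only [map_add]
        abel
      | single x m =>
        have hone : q (Finsupp.single g (Finsupp.single x 1 : Chain (ULift.{u} ℤ) F n n) +
            σ (d₁₀ A (Finsupp.single g (Finsupp.single x 1)))) ∈ Φ.range := by
          -- This Schreier-type element lies in the stabilizer. Expanding both sides of `g * t (g⁻¹
          -- • x) = t x * a`, with `a` scalar, by the boundary relation gives the claim.
          have hs : ((t x)⁻¹ * (g * t (g⁻¹ • x))) • x₀ = x₀ := by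
            rw [mul_smul, mul_smul, ht, smul_inv_smul, inv_smul_eq_iff, ht]
          obtain ⟨a, ha⟩ := Frame.eq_scalar_of_smul_eq hs
          rw [inv_mul_eq_iff_eq_mul] at ha
          refine ⟨Additive.ofMul a, (Submodule.Quotient.eq _).mpr ?_⟩
          have h1 := single_mul_sub_mem_boundaries₁ A g (t (g⁻¹ • x)) (Finsupp.single x 1)
          have h2 := single_mul_sub_mem_boundaries₁ A (t x) (GeneralLinearGroup.scalar (Fin n) a)
            (Finsupp.single x 1)
          have e1 : A.ρ g⁻¹ (Finsupp.single x 1) = Finsupp.single (g⁻¹ • x) 1 :=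
            chainRep_single n _ _ _
          have e2 : A.ρ (t x)⁻¹ (Finsupp.single x 1) = Finsupp.single x₀ 1 :=
            (chainRep_single n _ _ _).trans (by rw [inv_smul_eq_iff.mpr (ht x).symm])
          have e3 : d₁₀ A (Finsupp.single g (Finsupp.single x 1)) =
              (Finsupp.single (g⁻¹ • x) 1 - Finsupp.single x 1 : Chain (ULift.{u} ℤ) F n n) := by
            rw [d₁₀_single, e1]
          rw [e1] at h1
          rw [e2, ← ha] at h2
          rw [e3, map_sub, hσ, hσ, toMul_ofMul]
          convert sub_mem h1 h2 using 1
          abel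
        have hm : (Finsupp.single g (Finsupp.single x m : Chain (ULift.{u} ℤ) F n n) :
            GL (Fin n) F →₀ A) = m • Finsupp.single g
              (Finsupp.single x 1 : Chain (ULift.{u} ℤ) F n n) := by
          refine Eq.trans ?_ (Finsupp.smul_single _ _ _).symm
          refine congrArg (Finsupp.single g) (Eq.trans ?_ (Finsupp.smul_single _ _ _).symm)
          rw [smul_eq_mul, mul_one]
        -- The range of `Φ` is only an additive subgroup; integrality of the coefficients makes it
        -- stable under scaling.
        have hmem : ∀ w ∈ Φ.range, m • w ∈ Φ.range := fun w hw => by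
          have hc : m = ((m.down : ℤ) : ULift.{u} ℤ) := by ext; simp
          rw [hc, Int.cast_smul_eq_zsmul]
          exact zsmul_mem hw _
        rw [hm]
        have hT := (q ∘ₗ (LinearMap.id + σ ∘ₗ (d₁₀ A).hom)).map_smul m
          (Finsupp.single g (Finsupp.single x 1 : Chain (ULift.{u} ℤ) F n n))
        refine Eq.subst (motive := (· ∈ Φ.range)) hT.symm (hmem _ hone)
  intro z
  induction z using H1_induction_on with
  | h z =>
    obtain ⟨a, ha⟩ := key z.1
    rw [show d₁₀ A z.1 = 0 from z.2, map_zero, add_zero] at ha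
    exact ⟨a, H1π_eq_of_sub_mem A
      (x := ⟨_, (single_mem_cycles₁_iff _ _).mpr (scalarTrivial_chainRep n a.toMul _)⟩)
      ((Submodule.Quotient.eq _).mp ha)⟩

theorem H1π_surjective {k G : Type u} [CommRing k] [Group G] (A : Rep.{u} k G) :
    Function.Surjective (H1π A) :=
  (ModuleCat.epi_iff_surjective _).mp inferInstance

theorem liftAddHom_d₂₁ {k G : Type u} [CommRing k] [Group G] {A : Rep.{u} k G} {B : Type*}
    [AddCommGroup B] (φ : G → A →+ B)
    (hφ : ∀ g h c, φ (g * h) c = φ h (A.ρ g⁻¹ c) + φ g c) (c : G × G →₀ A) :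
    Finsupp.liftAddHom φ (d₂₁ A c) = 0 := by
  induction c using Finsupp.induction_linear with
  | zero => simp
  | add c d hc hd => rw [map_add, map_add, hc, hd, add_zero]
  | single g c =>
    rw [d₂₁_single, map_add, map_sub, Finsupp.liftAddHom_apply_single,
      Finsupp.liftAddHom_apply_single, Finsupp.liftAddHom_apply_single, hφ]
    abel

/-- The homomorphism on `H_1(G, A)` induced by a family of additive maps that vanishes on
boundaries. -/
def liftH1 {k G : Type u} [CommRing k] [Group G] (A : Rep.{u} k G) {B : Type*}
    [AddCommGroup B] (φ : G → A →+ B)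
    (hφ : ∀ g h c, φ (g * h) c = φ h (A.ρ g⁻¹ c) + φ g c) : H1 A →+ B :=
  (H1π A).hom.toAddMonoidHom.liftOfSurjective (H1π_surjective A)
    ⟨(Finsupp.liftAddHom φ).comp (cycles₁ A).subtype.toAddMonoidHom, fun z hz => by
      obtain ⟨c, hc⟩ := (H1π_eq_zero_iff z).mp hz
      have h := liftAddHom_d₂₁ φ hφ c
      rw [show d₂₁ _ c = z.1 from hc] at h
      exact h⟩

theorem liftH1_H1π {k G : Type u} [CommRing k] [Group G] (A : Rep.{u} k G) {B : Type*}
    [AddCommGroup B] (φ : G → A →+ B)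
    (hφ : ∀ g h c, φ (g * h) c = φ h (A.ρ g⁻¹ c) + φ g c) (z : cycles₁ A) :
    liftH1 A φ hφ (H1π A z) = Finsupp.liftAddHom φ z.1 :=
  AddMonoidHom.liftOfRightInverse_comp_apply _ _ _ _ z

/-- The factors of `g` on the first lines of the tuples of a chain. -/
def lineFactorHom (h : ℕ) (g : GL (Fin n) F) : Chain (ULift.{u} ℤ) F n h →+ Additive Fˣ :=
  Finsupp.liftAddHom fun x : Frame F n h =>
    ((zmultiplesHom (Additive Fˣ)) (Additive.ofMul (lineFactor g (x.1 0)))).comp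
      (AddEquiv.ulift : ULift.{u} ℤ ≃+ ℤ).toAddMonoidHom

theorem lineFactorHom_single (h : ℕ) (g : GL (Fin n) F) (x : Frame F n h) (m : ULift.{u} ℤ) :
    lineFactorHom h g (Finsupp.single x m) = m.down • Additive.ofMul (lineFactor g (x.1 0)) := by
  rw [lineFactorHom, Finsupp.liftAddHom_apply_single]
  rfl

theorem lineFactorHom_mul (h : ℕ) (g g' : GL (Fin n) F) (c : Chain (ULift.{u} ℤ) F n h) :
    lineFactorHom h (g * g') c =
      lineFactorHom h g' (chainRep (ULift.{u} ℤ) F n h g⁻¹ c) + lineFactorHom h g c := by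
  induction c using Finsupp.induction_linear with
  | zero => simp
  | add c d hc hd =>
    simp only [map_add, hc, hd]
    abel
  | single x m =>
    rw [chainRep_single, lineFactorHom_single, lineFactorHom_single, lineFactorHom_single,
      lineFactor_mul, ofMul_mul, zsmul_add, Frame.smul_val]

/-- The homomorphism `H_1(GL_n, C_h(F^n)) → F^*` given by the action on the first line. -/
def lineClass (h : ℕ) : H1 (Rep.of (chainRep (ULift.{u} ℤ) F n h)) →+ Additive Fˣ :=
  liftH1 _ (lineFactorHom h) (lineFactorHom_mul h)

theorem lineClass_scalarClass (h : ℕ) (a : Fˣ) (c : Chain (ULift.{u} ℤ) F n h) :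
    lineClass h (scalarClass (Rep.of (chainRep (ULift.{u} ℤ) F n h))
      (scalarTrivial_chainRep h) a c) = (augmentation _ h c).down • Additive.ofMul a := by
  rw [scalarClass_apply, lineClass, liftH1_H1π, Finsupp.liftAddHom_apply_single]
  induction c using Finsupp.induction_linear with
  | zero => simp
  | add c d hc hd => rw [map_add, hc, hd, map_add, ULift.add_down, add_zsmul]
  | single x m => rw [lineFactorHom_single, lineFactor_scalar, augmentation_single]

end FirstHomology

/-! ### The short exact sequence and its long exact sequence -/

section LongExactSequence

open CategoryTheory groupHomology Matrix

variable (k : Type u) [CommRing k] (F : Type u) [Field F]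

/-- The inclusion `∂_{n+1}(C_{n+1}(F^n)) → C_n(F^n)`. -/
def imageInclusion (n : ℕ) : boundaryImage k F n ⟶ Rep.of (chainRep k F n n) :=
  Rep.subtype (Rep.of (chainRep k F n n)) _ _

/-- The inclusion `H_{n-1}(X_n, k) → C_{n-1}(F^n)`, for `n = m + 2`. -/
def cycleInclusion (m : ℕ) : topHomology k F (m + 2) ⟶ Rep.of (chainRep k F (m + 2) (m + 1)) :=
  Rep.subtype (Rep.of (chainRep k F (m + 2) (m + 1))) _ _

/-- The differential `∂_n : C_n(F^n) → H_{n-1}(X_n, k)`, for `n = m + 2`. -/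
def boundaryToCycles (m : ℕ) :
    Rep.of (chainRep k F (m + 2) (m + 2)) ⟶ topHomology k F (m + 2) :=
  Rep.ofHom
    { toLinearMap := (boundary k F (m + 2) (m + 1)).codRestrict
        (boundaryHom k F (m + 2) m).ker.toSubmodule
        fun c => LinearMap.congr_fun (boundary_comp_boundary k m) c
      isIntertwining' := fun g => LinearMap.ext fun c => Subtype.ext
        (LinearMap.congr_fun ((boundaryHom k F (m + 2) (m + 1)).isIntertwining' g) c) }

theorem boundaryToCycles_val (m : ℕ) (c : Chain k F (m + 2) (m + 2)) :
    (cycleInclusion k F m).hom ((boundaryToCycles k F m).hom c) =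
      boundary k F (m + 2) (m + 1) c := rfl

/-- The short complex `∂_{n+1}(C_{n+1}(F^n)) → C_n(F^n) → H_{n-1}(X_n, k)`, for `n = m + 2`. -/
def boundaryShortComplex (m : ℕ) : ShortComplex (Rep.{u} k (GL (Fin (m + 2)) F)) where
  X₁ := boundaryImage k F (m + 2)
  X₂ := Rep.of (chainRep k F (m + 2) (m + 2))
  X₃ := topHomology k F (m + 2)
  f := imageInclusion k F (m + 2)
  g := boundaryToCycles k F m
  zero := by
    apply Rep.hom_ext
    apply Representation.IntertwiningMap.ext
    apply LinearMap.ext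
    rintro ⟨_, y, rfl⟩
    exact Subtype.ext (LinearMap.congr_fun (boundary_comp_boundary k (m + 1)) y)

/-- Exactness of the complex in degree `n` gives the middle term, and in degree `n - 1`, positive
since `n ≥ 2`, the surjectivity onto cycles. -/
theorem boundaryShortComplex_shortExact [Infinite F] (m : ℕ) :
    (boundaryShortComplex k F m).ShortExact where
  exact := (forget₂ (Rep k _) (ModuleCat k)).reflects_exact_of_faithful _ <|
    (ShortComplex.moduleCat_exact_iff _).2 fun x hx => by
      obtain ⟨y, hy⟩ := exists_boundary_eq k (F := F) (n := m + 2) (Nat.succ_pos _)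
        (z := x) (congrArg Subtype.val hx)
      exact ⟨⟨x, y, hy⟩, rfl⟩
  mono_f := (Rep.mono_iff_injective _).2 fun _ _ h => Subtype.ext h
  epi_g := (Rep.epi_iff_surjective _).2 fun z => by
    obtain ⟨y, hy⟩ := exists_boundary_eq k (F := F) (n := m + 2) (Nat.succ_pos _)
      (z := z.1) z.2
    exact ⟨y, Subtype.ext hy⟩

theorem scalarTrivial_topHomology (m : ℕ) : ScalarTrivial (topHomology k F (m + 2)) :=
  (scalarTrivial_chainRep (k := k) (F := F) (n := m + 2) (m + 1)).subrepresentation _ _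

variable (m : ℕ)

/-- The connecting homomorphism `H_1(GL_n, H_{n-1}(X_n, k)) → H_0(GL_n, ∂_{n+1}(C_{n+1}(F^n)))`. -/
def connecting [Infinite F] : tGroupCoeff k F (m + 2) →+ preBlochCoeff k F (m + 2) :=
  (δ (boundaryShortComplex_shortExact k F m) 1 0 rfl).hom.toAddMonoidHom

theorem connecting_eq_zero_iff [Infinite F] (z : tGroupCoeff k F (m + 2)) :
    connecting k F m z = 0 ↔
      ∃ y, groupHomology.map (MonoidHom.id _) (boundaryToCycles k F m) 1 y = z := by
  have h := mapShortComplex₃_exact (boundaryShortComplex_shortExact k F m) (i := 1) (j := 0) rfl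
  constructor
  · exact fun hz => (ShortComplex.moduleCat_exact_iff _).mp h z hz
  · rintro ⟨y, rfl⟩
    exact ShortComplex.moduleCat_zero_apply
      (mapShortComplex₃ (boundaryShortComplex_shortExact k F m) (i := 1) (j := 0) rfl) y

/-- The map `H_0(GL_n, ∂_{n+1}(C_{n+1}(F^n))) → k` induced by the augmentation of `C_n(F^n)`. -/
def preBlochAugmentation : preBlochCoeff k F (m + 2) →+ k :=
  ((augmentationH0 k (m + 2) : H0 (Rep.of (chainRep k F (m + 2) (m + 2))) →ₗ[k] k) ∘ₗ
    (groupHomology.map (MonoidHom.id _) (imageInclusion k F (m + 2)) 0).hom).toAddMonoidHom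

theorem preBlochAugmentation_H0π (c : boundaryImage k F (m + 2)) :
    preBlochAugmentation k F m (H0π (boundaryImage k F (m + 2)) c) =
      augmentation k (m + 2) ((imageInclusion k F (m + 2)).hom c) := by
  exact (congrArg (augmentationH0 k (m + 2)) (map_H0π (imageInclusion k F (m + 2)) c)).trans (augmentationH0_H0π (m + 2) _)

/-- Exactness at `p_n`, with vanishing in `H_0(GL_n, C_n)` detected by the injective augmentation.
-/
theorem preBlochAugmentation_eq_zero_iff [Infinite F] (z : preBlochCoeff k F (m + 2)) :
    preBlochAugmentation k F m z = 0 ↔ ∃ y, connecting k F m y = z := by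
  have h := mapShortComplex₁_exact (boundaryShortComplex_shortExact k F m) (i := 1) (j := 0) rfl
  obtain ⟨x₀⟩ := nonempty_frame (F := F) (n := m + 2) (Nat.succ_pos _) (m + 2)
  constructor
  · intro hz
    refine (ShortComplex.moduleCat_exact_iff _).mp h z ?_
    exact augmentationH0_injective x₀ (hz.trans (map_zero _).symm)
  · rintro ⟨y, rfl⟩
    refine Eq.trans (congrArg (augmentationH0 k (m + 2)) ?_) (map_zero _)
    exact ShortComplex.moduleCat_zero_apply
      (mapShortComplex₁ (boundaryShortComplex_shortExact k F m) (i := 1) (j := 0) rfl) y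

theorem preBlochAugmentation_of_even (hm : Even m) (z : preBlochCoeff k F (m + 2)) :
    preBlochAugmentation k F m z = 0 := by
  induction z using H0_induction_on with
  | h c =>
    obtain ⟨_, y, rfl⟩ := c
    refine (preBlochAugmentation_H0π k F m _).trans ?_
    refine (augmentation_boundary (m + 2) y).trans (if_pos ?_)
    simpa [Nat.even_add] using hm

theorem exists_preBlochAugmentation_eq_one [Infinite F] (hm : ¬ Even m) :
    ∃ z, preBlochAugmentation k F m z = 1 := by
  obtain ⟨y⟩ := nonempty_frame (F := F) (n := m + 2) (Nat.succ_pos _) (m + 3)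
  refine ⟨H0π _ ⟨boundary k F (m + 2) (m + 2) (Finsupp.single y 1), _, rfl⟩, ?_⟩
  refine (preBlochAugmentation_H0π k F m _).trans ?_
  refine (augmentation_boundary (m + 2) _).trans ((if_neg ?_).trans (augmentation_single ..))
  simpa [Nat.even_add] using hm

end LongExactSequence

/-! ### The map from `F^*` to `t_n`, and the two splittings -/

section Integral

open CategoryTheory groupHomology Matrix

variable (F : Type u) [Field F] (m : ℕ)

/-- The homomorphism `F^* = H_1(GL_n, C_n(F^n)) → t_n(F)` defined by a frame. -/
def unitsToTGroup (x₀ : Frame F (m + 2) (m + 2)) : Additive Fˣ →+ tGroup F (m + 2) :=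
  scalarHom (topHomology (ULift.{u} ℤ) F (m + 2)) (scalarTrivial_topHomology _ F m)
    ((boundaryToCycles (ULift.{u} ℤ) F m).hom (Finsupp.single x₀ 1))

variable {F m}

theorem map_boundaryToCycles_scalarClass (a : Fˣ) (c : Chain (ULift.{u} ℤ) F (m + 2) (m + 2)) :
    groupHomology.map (MonoidHom.id _) (boundaryToCycles (ULift.{u} ℤ) F m) 1
      (scalarClass _ (scalarTrivial_chainRep (m + 2)) a c) =
      scalarClass _ (scalarTrivial_topHomology _ F m) a
        ((boundaryToCycles (ULift.{u} ℤ) F m).hom c) :=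
  map_scalarClass _ _ _ _ _

/-- Exactness at `t_n`, since every class in `H_1(GL_n, C_n)` is a scalar class. -/
theorem exists_unitsToTGroup_eq_iff [Infinite F] (x₀ : Frame F (m + 2) (m + 2)) (z : tGroup F (m + 2)) :
    (∃ a, unitsToTGroup F m x₀ a = z) ↔ connecting (ULift.{u} ℤ) F m z = 0 := by
  rw [connecting_eq_zero_iff]
  constructor
  · rintro ⟨a, rfl⟩
    exact ⟨_, map_boundaryToCycles_scalarClass a.toMul _⟩
  · rintro ⟨y, rfl⟩
    obtain ⟨a, rfl⟩ := exists_scalarHom_eq x₀ y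
    exact ⟨a, (map_boundaryToCycles_scalarClass a.toMul _).symm⟩

/-- For `n` odd, `∂y` has augmentation `1`, so it defines the same scalar class as `x₀` in
`H_1(C_n)`; its image in `t_n` vanishes because `∂∂y = 0`. -/
theorem unitsToTGroup_of_odd [Infinite F] (hm : ¬ Even m) (x₀ : Frame F (m + 2) (m + 2)) (a : Additive Fˣ) :
    unitsToTGroup F m x₀ a = 0 := by
  obtain ⟨y⟩ := nonempty_frame (F := F) (n := m + 2) (Nat.succ_pos _) (m + 3)
  have haug : augmentation (ULift.{u} ℤ) (m + 2)
      (boundary (ULift.{u} ℤ) F (m + 2) (m + 2) (Finsupp.single y 1)) = 1 :=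
    (augmentation_boundary (m + 2) _).trans
      ((if_neg (by simpa [Nat.even_add] using hm)).trans (augmentation_single ..))
  have h1 := scalarClass_congr x₀ a.toMul (haug.trans (augmentation_single _ x₀ 1).symm)
  have h2 := map_boundaryToCycles_scalarClass a.toMul
    (boundary (ULift.{u} ℤ) F (m + 2) (m + 2) (Finsupp.single y 1))
  rw [h1, map_boundaryToCycles_scalarClass] at h2
  refine h2.trans ?_
  have h3 : (boundaryToCycles (ULift.{u} ℤ) F m).hom
      (boundary (ULift.{u} ℤ) F (m + 2) (m + 2) (Finsupp.single y 1)) = 0 :=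
    Subtype.ext (boundary_boundary_single _ (m + 1) y 1)
  rw [h3, map_zero]

variable (F m) in
/-- The map `t_n(F) → H_1(GL_n, C_{n-1}(F^n)) → F^*` given by the action on the first line. -/
def tGroupToUnits : tGroup F (m + 2) →+ Additive Fˣ :=
  (lineClass (m + 1)).comp
    (groupHomology.map (MonoidHom.id _) (cycleInclusion (ULift.{u} ℤ) F m) 1).hom.toAddMonoidHom

/-- For `n` even, `∂_n x₀` has augmentation `1` in `C_{n-1}`, and the scalar `a` acts on every line
with factor `a`. -/
theorem tGroupToUnits_unitsToTGroup (hm : Even m) (x₀ : Frame F (m + 2) (m + 2))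
    (a : Additive Fˣ) : tGroupToUnits F m (unitsToTGroup F m x₀ a) = a := by
  have h1 := map_scalarClass (cycleInclusion (ULift.{u} ℤ) F m)
    (scalarTrivial_topHomology _ F m) (scalarTrivial_chainRep (m + 1)) a.toMul
    ((boundaryToCycles (ULift.{u} ℤ) F m).hom (Finsupp.single x₀ 1))
  refine (congrArg (lineClass (m + 1)) h1).trans ?_
  rw [boundaryToCycles_val]
  refine (lineClass_scalarClass (m + 1) a.toMul _).trans ?_
  rw [augmentation_boundary, if_neg (by simpa [Nat.even_add_one] using hm), augmentation_single]
  simp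

theorem nonempty_tGroup_equiv [Infinite F] (hm : Even m) :
    Nonempty (tGroup F (m + 2) ≃+ Additive Fˣ × preBlochGroup F (m + 2)) := by
  obtain ⟨x₀⟩ := nonempty_frame (F := F) (n := m + 2) (Nat.succ_pos _) (m + 2)
  refine ⟨AddEquiv.ofBijective ((tGroupToUnits F m).prod (connecting (ULift.{u} ℤ) F m)) ⟨?_, ?_⟩⟩
  · rw [injective_iff_map_eq_zero]
    intro z hz
    obtain ⟨h1, h2⟩ := Prod.ext_iff.mp hz
    obtain ⟨a, rfl⟩ := (exists_unitsToTGroup_eq_iff x₀ z).mpr h2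
    have h3 : a = 0 := (tGroupToUnits_unitsToTGroup hm x₀ a).symm.trans h1
    rw [h3, map_zero]
  · rintro ⟨a, p⟩
    obtain ⟨z, rfl⟩ := (preBlochAugmentation_eq_zero_iff _ F m p).mp
      (preBlochAugmentation_of_even _ F m hm p)
    -- The correction adjusts the first coordinate and lies in the kernel of the connecting map.
    refine ⟨z + unitsToTGroup F m x₀ (a - tGroupToUnits F m z), Prod.ext ?_ ?_⟩
    · change tGroupToUnits F m _ = a
      rw [map_add, tGroupToUnits_unitsToTGroup hm, add_sub_cancel]
    · change connecting (ULift.{u} ℤ) F m _ = _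
      rw [map_add, (exists_unitsToTGroup_eq_iff x₀ _).mp ⟨_, rfl⟩, add_zero]

theorem nonempty_preBlochGroup_equiv [Infinite F] (hm : ¬ Even m) :
    Nonempty (preBlochGroup F (m + 2) ≃+ ℤ × tGroup F (m + 2)) := by
  obtain ⟨x₀⟩ := nonempty_frame (F := F) (n := m + 2) (Nat.succ_pos _) (m + 2)
  obtain ⟨p, hp⟩ := exists_preBlochAugmentation_eq_one (ULift.{u} ℤ) F m hm
  let e : preBlochGroup F (m + 2) →+ ℤ :=
    (AddEquiv.ulift : ULift.{u} ℤ ≃+ ℤ).toAddMonoidHom.comp (preBlochAugmentation (ULift.{u} ℤ) F m)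
  have he : ∀ z, e z = 0 ↔ ∃ y, connecting (ULift.{u} ℤ) F m y = z := fun z => by
    rw [← preBlochAugmentation_eq_zero_iff]
    exact map_eq_zero_iff _ (AddEquiv.ulift : ULift.{u} ℤ ≃+ ℤ).injective
  have hep : e p = 1 := congrArg ULift.down hp
  -- The element `p` of augmentation `1` splits the surjection onto `ℤ`, whose kernel is the image
  -- of `t_n`.
  let Ψ : ℤ × tGroup F (m + 2) →+ preBlochGroup F (m + 2) :=
    (zmultiplesHom _ p).coprod (connecting (ULift.{u} ℤ) F m)
  have hΨ : ∀ i t, Ψ (i, t) = i • p + connecting (ULift.{u} ℤ) F m t := fun i t => rfl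
  have heΨ : ∀ i t, e (Ψ (i, t)) = i := fun i t => by
    rw [hΨ, map_add, map_zsmul, hep, (he _).mpr ⟨t, rfl⟩]
    simp
  refine ⟨(AddEquiv.ofBijective Ψ ⟨?_, ?_⟩).symm⟩
  · rw [injective_iff_map_eq_zero]
    rintro ⟨i, t⟩ h
    have hi : i = 0 := by rw [← heΨ i t, h, map_zero]
    subst hi
    rw [hΨ, zero_smul, zero_add, ← exists_unitsToTGroup_eq_iff x₀] at h
    obtain ⟨a, rfl⟩ := h
    rw [unitsToTGroup_of_odd hm]
    rfl
  · intro z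
    obtain ⟨t, ht⟩ := (he (z - e z • p)).mp (by
      rw [map_sub, map_zsmul, hep, smul_eq_mul, mul_one, sub_self])
    exact ⟨(e z, t), by rw [hΨ, ht, add_sub_cancel]⟩

end Integral

end PreBloch

end

theorem lemma2p3 {F : Type*} [Field F] [Infinite F] (n : ℕ) (hn : 2 ≤ n) :
    (Even n → Nonempty
      (PreBloch.tGroup F n ≃+ Additive Fˣ × PreBloch.preBlochGroup F n)) ∧
    (Odd n → Nonempty
      (PreBloch.preBlochGroup F n ≃+ ℤ × PreBloch.tGroup F n)) := by
  obtain ⟨m, rfl⟩ := Nat.exists_eq_add_of_le' hn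
  refine ⟨fun h => PreBloch.nonempty_tGroup_equiv ?_,
    fun h => PreBloch.nonempty_preBlochGroup_equiv ?_⟩
  · simpa [Nat.even_add] using h
  · simpa [← Nat.not_even_iff_odd, Nat.even_add] using h
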